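/- Number the $54$ stickers of the $3\times3\times3$ Rubik's cube $1,\dots,54$, row by row on each face of the unfolded cube: up $1$–$9$, left $10$–$18$, front $19$–$27$, right $28$–$36$, back $37$–$45$, down $46$–$54$, where the left, front, right and back faces form a horizontal strip in this order, the up face lies above the front face and the down face lies below it. The clockwise quarter turns of the six faces are the following permutations of the stickers: \begin{align*} R&=(28\,30\,36\,34)(29\,33\,35\,31)(3\,43\,48\,21)(6\,40\,51\,24)(9\,37\,54\,27),\\ L&=(10\,12\,18\,16)(11\,15\,17\,13)(1\,19\,46\,45)(4\,22\,49\,42)(7\,25\,52\,39),\\ U&=(1\,3\,9\,7)(2\,6\,8\,4)(10\,37\,28\,19)(11\,38\,29\,20)(12\,39\,30\,21),\\ D&=(46\,48\,54\,52)(47\,51\,53\,49)(16\,25\,34\,43)(17\,26\,35\,44)(18\,27\,36\,45),\\ F&=(19\,21\,27\,25)(20\,24\,26\,22)(7\,28\,48\,18)(8\,31\,47\,15)(9\,34\,46\,12),\\ B&=(37\,39\,45\,43)(38\,42\,44\,40)(1\,16\,54\,30)(2\,13\,53\,33)(3\,10\,52\,36). \end{align*} The positions of the cube are the elements of the Rubik's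 cube group $\mathcal R=\langle R,L,U,D,F,B\rangle\le S_{54}$, and the solved position is the identity. A move (in the half-turn metric) is one of the $18$ permutations $M, M^{-1}, M^2$ with $M\in\{R,L,U,D,F,B\}$; applying a move $s$ to a position $u$ gives $u\circ s$. **Lemma (Human's Number).** Every position of the Rubik's cube can be solved in at most $205$ moves: for every $g\in\mathcal R$ there are $k\le 205$ and moves $s_1,\dots,s_k$ such that $g\circ s_1\circ\cdots\circ s_k=\mathrm{id}$. -/

import Mathlib

namespace Rubik

/-- The `54` stickers of the `3 × 3 × 3` cube, numbered row by row on the unfolded cube: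
the up face carries `1, …, 9`, the left face `10, …, 18`, the front face `19, …, 27`, the right
face `28, …, 36`, the back face `37, …, 45` and the down face `46, …, 54`:
```
           1  2  3
           4  5  6
           7  8  9
10 11 12  19 20 21  28 29 30  37 38 39
13 14 15  22 23 24  31 32 33  40 41 42
16 17 18  25 26 27  34 35 36  43 44 45
          46 47 48
          49 50 51
          52 53 54
```
Numbers are read modulo `54` in `Fin 54`, so sticker number `54` is the element `0`. -/
abbrev Sticker : Type := Fin 54

/-- The `4`-cycle `a ↦ b ↦ c ↦ d ↦ a` of stickers. -/
def cyc (a b c d : Sticker) : Equiv.Perm Sticker := [a, b, c, d].formPerm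

/-- Clockwise quarter turn of the right face. -/
def R : Equiv.Perm Sticker :=
  cyc 28 30 36 34 * cyc 29 33 35 31 * cyc 3 43 48 21 * cyc 6 40 51 24 * cyc 9 37 54 27

/-- Clockwise quarter turn of the left face. -/
def L : Equiv.Perm Sticker :=
  cyc 10 12 18 16 * cyc 11 15 17 13 * cyc 1 19 46 45 * cyc 4 22 49 42 * cyc 7 25 52 39

/-- Clockwise quarter turn of the up face. -/
def U : Equiv.Perm Sticker :=
  cyc 1 3 9 7 * cyc 2 6 8 4 * cyc 10 37 28 19 * cyc 11 38 29 20 * cyc 12 39 30 21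

/-- Clockwise quarter turn of the down face. -/
def D : Equiv.Perm Sticker :=
  cyc 46 48 54 52 * cyc 47 51 53 49 * cyc 16 25 34 43 * cyc 17 26 35 44 * cyc 18 27 36 45

/-- Clockwise quarter turn of the front face. -/
def F : Equiv.Perm Sticker :=
  cyc 19 21 27 25 * cyc 20 24 26 22 * cyc 7 28 48 18 * cyc 8 31 47 15 * cyc 9 34 46 12

/-- Clockwise quarter turn of the back face. -/
def B : Equiv.Perm Sticker :=
  cyc 37 39 45 43 * cyc 38 42 44 40 * cyc 1 16 54 30 * cyc 2 13 53 33 * cyc 3 10 52 36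

/-- The Rubik's cube group. Its elements are the positions of the cube (the states reachable from
the solved one); the solved position is `1`. -/
def cubeGroup : Subgroup (Equiv.Perm Sticker) :=
  Subgroup.closure {R, L, U, D, F, B}

/-- The `18` moves of the half-turn metric: turning one face by `90`, `270` or `180` degrees. -/
def moves : Set (Equiv.Perm Sticker) :=
  {R, R⁻¹, R ^ 2, L, L⁻¹, L ^ 2, U, U⁻¹, U ^ 2, D, D⁻¹, D ^ 2, F, F⁻¹, F ^ 2, B, B⁻¹, B ^ 2}

/-- The position `g` can be solved in at most `n` moves: some sequence `m₁, …, mₖ` of `k ≤ n` moves,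
applied one after the other (a move `m` takes a position `u` to `u * m`), takes `g` to the solved
position. -/
def SolvableIn (g : Equiv.Perm Sticker) (n : ℕ) : Prop :=
  ∃ ms : List (Equiv.Perm Sticker),
    ms.length ≤ n ∧ (∀ m ∈ ms, m ∈ moves) ∧ ms.foldl (fun u m => u * m) g = 1

end Rubik

/-!
The proof solves the cube one piece at a time, in the manner of a stabiliser chain. Let `h` be the
inverse of the position to be solved, and suppose `h` fixes the stickers `b₁, …, bᵢ`, one on each
of `i` pieces. If `w` is a product of moves that fixes `b₁, …, bᵢ` and agrees with `h` at a further
sticker `b`, then `w⁻¹ * h` fixes `b₁, …, bᵢ, b`. So it is enough to have, for every level of the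
chain, a list of words reaching all stickers to which `h` can send `b` (`wordTable`, checked by
computation in `isChain_wordTable`); the longest words of the levels add up to `119` moves.

Where `h` can send `b` is controlled by the invariants of the cube, collected in `legalGroup`: an
element of the cube group permutes the pieces evenly, preserves their kinds, and changes their
orientations by amounts with sum zero. The table treats all corner and edge pieces but the edge
up-left and the corners up-back-left and up-back-right. Once the others are in place,
parity forbids exchanging the two corners, so the corner up-back-left is at most twisted
(`upBackLeft_mem`). A word of `18` moves, used at most twice, undoes the twist, after which the
orientation sum leaves nothing else to do (`eq_one_of_fixes_all_but_two`). This takes at most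
`119 + 36 = 155` moves.
-/

namespace Rubik

open Equiv

/-! ### Moves and words -/

/-- Names of the `18` moves: a face and the number of its clockwise quarter turns. -/
inductive Turn
  | R1 | R2 | R3 | L1 | L2 | L3 | U1 | U2 | U3 | D1 | D2 | D3 | F1 | F2 | F3 | B1 | B2 | B3

namespace Turn

/-- The permutation of the stickers that a move performs. -/
def perm : Turn → Perm Sticker
  | R1 => R | R2 => R ^ 2 | R3 => R⁻¹
  | L1 => L | L2 => L ^ 2 | L3 => L⁻¹
  | U1 => U | U2 => U ^ 2 | U3 => U⁻¹
  | D1 => D | D2 => D ^ 2 | D3 => D⁻¹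
  | F1 => F | F2 => F ^ 2 | F3 => F⁻¹
  | B1 => B | B2 => B ^ 2 | B3 => B⁻¹

theorem perm_mem_moves (t : Turn) : t.perm ∈ moves := by
  cases t <;> simp [perm, moves]

theorem perm_mem_cubeGroup (t : Turn) : t.perm ∈ cubeGroup := by
  have hg : ∀ g ∈ ({R, L, U, D, F, B} : Set (Perm Sticker)), g ∈ cubeGroup :=
    fun g hg => Subgroup.subset_closure hg
  simp only [Set.mem_insert_iff, Set.mem_singleton_iff, forall_eq_or_imp, forall_eq] at hg
  obtain ⟨hR, hL, hU, hD, hF, hB⟩ := hg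
  cases t
  exacts [hR, pow_mem hR 2, inv_mem hR, hL, pow_mem hL 2, inv_mem hL, hU, pow_mem hU 2, inv_mem hU,
    hD, pow_mem hD 2, inv_mem hD, hF, pow_mem hF 2, inv_mem hF, hB, pow_mem hB 2, inv_mem hB]

/-- The images of the stickers under the quarter turn of the right face, listed from sticker `0`
(that is, number `54`) on. -/
def tableR : List Sticker :=
  [27, 1, 2, 43, 4, 5, 40, 7, 8, 37, 10, 11, 12, 13, 14, 15, 16, 17,
     18, 19, 20, 3, 22, 23, 6, 25, 26, 9, 30, 33, 36, 29, 32, 35, 28, 31,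
     34, 0, 38, 39, 51, 41, 42, 48, 44, 45, 46, 47, 21, 49, 50, 24, 52, 53]

/-- The images of the stickers under the quarter turn of the left face, from sticker `0` on. -/
def tableL : List Sticker :=
  [0, 19, 2, 3, 22, 5, 6, 25, 8, 9, 12, 15, 18, 11, 14, 17, 10, 13,
     16, 46, 20, 21, 49, 23, 24, 52, 26, 27, 28, 29, 30, 31, 32, 33, 34, 35,
     36, 37, 38, 7, 40, 41, 4, 43, 44, 1, 45, 47, 48, 42, 50, 51, 39, 53]

/-- The images of the stickers under the quarter turn of the up face, from sticker `0` on. -/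
def tableU : List Sticker :=
  [0, 3, 6, 9, 2, 5, 8, 1, 4, 7, 37, 38, 39, 13, 14, 15, 16, 17,
     18, 10, 11, 12, 22, 23, 24, 25, 26, 27, 19, 20, 21, 31, 32, 33, 34, 35,
     36, 28, 29, 30, 40, 41, 42, 43, 44, 45, 46, 47, 48, 49, 50, 51, 52, 53]

/-- The images of the stickers under the quarter turn of the down face, from sticker `0` on. -/
def tableD : List Sticker :=
  [52, 1, 2, 3, 4, 5, 6, 7, 8, 9, 10, 11, 12, 13, 14, 15, 25, 26,
     27, 19, 20, 21, 22, 23, 24, 34, 35, 36, 28, 29, 30, 31, 32, 33, 43, 44,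
     45, 37, 38, 39, 40, 41, 42, 16, 17, 18, 48, 51, 0, 47, 50, 53, 46, 49]

/-- The images of the stickers under the quarter turn of the front face, from sticker `0` on. -/
def tableF : List Sticker :=
  [0, 1, 2, 3, 4, 5, 6, 28, 31, 34, 10, 11, 9, 13, 14, 8, 16, 17,
     7, 21, 24, 27, 20, 23, 26, 19, 22, 25, 48, 29, 30, 47, 32, 33, 46, 35,
     36, 37, 38, 39, 40, 41, 42, 43, 44, 45, 12, 15, 18, 49, 50, 51, 52, 53]

/-- The images of the stickers under the quarter turn of the back face, from sticker `0` on. -/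
def tableB : List Sticker :=
  [30, 16, 13, 10, 4, 5, 6, 7, 8, 9, 52, 11, 12, 53, 14, 15, 0, 17,
     18, 19, 20, 21, 22, 23, 24, 25, 26, 27, 28, 29, 1, 31, 32, 2, 34, 35,
     3, 39, 42, 45, 38, 41, 44, 37, 40, 43, 46, 47, 48, 49, 50, 51, 36, 33]

/-- The action of `Turn.perm` on stickers, by table lookup, which the kernel evaluates more cheaply
than a product of cycles. -/
def act (t : Turn) (x : Sticker) : Sticker :=
  let f (l : List Sticker) (y : Sticker) : Sticker := l.getD y.val 0
  match t with
  | R1 => f tableR x | R2 => f tableR (f tableR x) | R3 => f tableR (f tableR (f tableR x))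
  | L1 => f tableL x | L2 => f tableL (f tableL x) | L3 => f tableL (f tableL (f tableL x))
  | U1 => f tableU x | U2 => f tableU (f tableU x) | U3 => f tableU (f tableU (f tableU x))
  | D1 => f tableD x | D2 => f tableD (f tableD x) | D3 => f tableD (f tableD (f tableD x))
  | F1 => f tableF x | F2 => f tableF (f tableF x) | F3 => f tableF (f tableF (f tableF x))
  | B1 => f tableB x | B2 => f tableB (f tableB x) | B3 => f tableB (f tableB (f tableB x))

theorem perm_apply (t : Turn) (x : Sticker) : t.perm x = t.act x := by
  revert x
  cases t <;> decide +kernel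

end Turn

/-- A product of moves, written from left to right; as permutations compose from right to left, the
rightmost letter acts first. -/
abbrev Word : Type := List Turn

namespace Word

/-- The permutation that a word spells. -/
def perm (w : Word) : Perm Sticker := (w.map Turn.perm).prod

/-- The action of `Word.perm` on stickers, in terms of `Turn.act`. -/
def act (w : Word) (x : Sticker) : Sticker := w.foldr Turn.act x

theorem perm_apply (w : Word) (x : Sticker) : w.perm x = w.act x := by
  induction w with
  | nil => rfl
  | cons t w ih =>
    have : perm (t :: w) = t.perm * perm w := by simp [perm]
    rw [this, Perm.mul_apply, ih, Turn.perm_apply]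
    rfl

theorem perm_mem_cubeGroup (w : Word) : w.perm ∈ cubeGroup := by
  refine list_prod_mem fun g hg => ?_
  obtain ⟨t, -, rfl⟩ := List.mem_map.1 hg
  exact t.perm_mem_cubeGroup

end Word

/-- `h` is a product of at most `n` moves. -/
def IsProd (h : Perm Sticker) (n : ℕ) : Prop :=
  ∃ w : Word, w.length ≤ n ∧ w.perm = h

theorem IsProd.mono {h : Perm Sticker} {m n : ℕ} (hm : IsProd h m) (hmn : m ≤ n) : IsProd h n :=
  let ⟨w, hw, hh⟩ := hm
  ⟨w, hw.trans hmn, hh⟩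

theorem IsProd.of_inv_mul {h : Perm Sticker} {w : Word} {k n : ℕ} (hk : w.length ≤ k)
    (hn : IsProd (w.perm⁻¹ * h) n) : IsProd h (k + n) := by
  obtain ⟨w', hw', hh⟩ := hn
  refine ⟨w ++ w', by simpa using Nat.add_le_add hk hw', ?_⟩
  have : Word.perm (w ++ w') = w.perm * w'.perm := by simp [Word.perm]
  rw [this, hh, mul_inv_cancel_left]

theorem foldl_mul_eq (ms : List (Perm Sticker)) (g : Perm Sticker) :
    ms.foldl (fun u m => u * m) g = g * ms.prod := by
  induction ms generalizing g with
  | nil => simp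
  | cons m ms ih => simp [ih, mul_assoc]

theorem SolvableIn.of_isProd_inv {g : Perm Sticker} {n : ℕ} (h : IsProd g⁻¹ n) :
    SolvableIn g n := by
  obtain ⟨w, hw, hg⟩ := h
  refine ⟨w.map Turn.perm, by simpa using hw, fun m hm => ?_, ?_⟩
  · obtain ⟨t, -, rfl⟩ := List.mem_map.1 hm
    exact t.perm_mem_moves
  · rw [foldl_mul_eq, show (w.map Turn.perm).prod = g⁻¹ from hg, mul_inv_cancel]

/-! ### Pieces, orientations and the invariants of the cube group -/

/-- The piece carrying a sticker: corners are `0, …, 7`, edges `8, …, 19` and centres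
`20, …, 25`. The list starts with sticker `0`, that is, number `54`. -/
def piece (x : Sticker) : Fin 26 :=
  List.getD
    [7, 2, 11, 3, 9, 20, 10, 0, 8, 1, 2, 9, 0, 15, 21, 12, 6, 17,
     4, 0, 8, 1, 12, 22, 13, 4, 16, 5, 1, 10, 3, 13, 23, 14, 5, 18,
     7, 3, 11, 2, 14, 24, 15, 7, 19, 6, 4, 16, 5, 17, 25, 18, 6, 19] x.val 0

/-- The position of a sticker on its piece. The stickers of a corner have the values `0, 2, 4` in
clockwise order and those of an edge the values `0, 3`, so that the twists of corners (modulo `3`)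
and the flips of edges (modulo `2`) are both recorded in `ZMod 6`. -/
def orient (x : Sticker) : ZMod 6 :=
  List.getD
    [0, 0, 0, 0, 0, 0, 0, 0, 0, 0, 2, 3, 4, 3, 0, 3, 4, 3,
     2, 2, 3, 4, 0, 0, 0, 4, 3, 2, 2, 3, 4, 3, 0, 3, 4, 3,
     2, 2, 3, 4, 0, 0, 0, 4, 3, 2, 0, 0, 0, 0, 0, 0, 0, 0] x.val 0

/-- The kind of a piece: `0` for a corner, `1` for an edge; each centre is a kind of its own. -/
def kind (i : Fin 26) : ℕ :=
  if i.val < 8 then 0 else if i.val < 20 then 1 else i.val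

theorem sticker_ext {x y : Sticker} (hp : piece x = piece y) (ho : orient x = orient y) :
    x = y := by
  have : ∀ x y, piece x = piece y → orient x = orient y → x = y := by decide +kernel
  exact this x y hp ho

theorem three_mul_orient_of_corner (x : Sticker) : kind (piece x) = 0 → 3 * orient x = 0 := by
  revert x
  decide +kernel

theorem two_mul_orient_of_edge (x : Sticker) : kind (piece x) = 1 → 2 * orient x = 0 := by
  revert x
  decide +kernel

theorem orient_of_centre (x : Sticker) : 2 ≤ kind (piece x) → orient x = 0 := by
  revert x
  decide +kernel

theorem exists_piece_eq (i : Fin 26) : ∃ x, piece x = i := by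
  revert i
  decide +kernel

/-- The permutation `h` of the stickers moves whole pieces, by the permutation `σ`, and rotates the
piece `i` by `v i`; the permutation of the pieces is even and preserves their kinds, and the
rotations have sum zero. -/
structure IsLegal (h : Perm Sticker) (σ : Perm (Fin 26)) (v : Fin 26 → ZMod 6) : Prop where
  sign_eq : Perm.sign σ = 1
  kind_eq : ∀ i, kind (σ i) = kind i
  sum_eq : ∑ i, v i = 0
  piece_apply : ∀ x, piece (h x) = σ (piece x)
  orient_apply : ∀ x, orient (h x) = orient x + v (piece x)

theorem apply_inv_apply {α : Type*} (h : Perm α) (x : α) : h (h⁻¹ x) = x :=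
  Perm.eq_inv_iff_eq.1 rfl

/-- The permutations of the stickers that satisfy the invariants of the cube. -/
def legalGroup : Subgroup (Perm Sticker) where
  carrier := {h | ∃ σ v, IsLegal h σ v}
  one_mem' := ⟨1, 0, by simp, by simp, by simp, by simp, by simp⟩
  mul_mem' := by
    rintro g h ⟨σ, v, hg⟩ ⟨τ, u, hh⟩
    refine ⟨σ * τ, fun i => u i + v (τ i), ?_, fun i => ?_, ?_, fun x => ?_, fun x => ?_⟩
    · rw [map_mul, hg.sign_eq, hh.sign_eq, mul_one]
    · rw [Perm.mul_apply, hg.kind_eq, hh.kind_eq]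
    · rw [Finset.sum_add_distrib, hh.sum_eq, Equiv.sum_comp τ v, hg.sum_eq, add_zero]
    · rw [Perm.mul_apply, hg.piece_apply, hh.piece_apply, Perm.mul_apply]
    · rw [Perm.mul_apply, hg.orient_apply, hh.orient_apply, hh.piece_apply, add_assoc]
  inv_mem' := by
    rintro h ⟨σ, v, hh⟩
    have hp (x : Sticker) : piece (h⁻¹ x) = σ⁻¹ (piece x) := by
      rw [Perm.eq_inv_iff_eq, ← hh.piece_apply, apply_inv_apply]
    refine ⟨σ⁻¹, fun i => -v (σ⁻¹ i), ?_, fun i => ?_, ?_, hp, fun x => ?_⟩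
    · rw [Perm.sign_inv, hh.sign_eq]
    · rw [← hh.kind_eq, apply_inv_apply]
    · rw [Finset.sum_neg_distrib, Equiv.sum_comp σ⁻¹ v, hh.sum_eq, neg_zero]
    · have := hh.orient_apply (h⁻¹ x)
      rw [apply_inv_apply, hp] at this
      rw [this, add_neg_cancel_right]

theorem sign_formPerm_mul_formPerm {a b c d e f g h : Fin 26} (h₁ : [a, b, c, d].Nodup)
    (h₂ : [e, f, g, h].Nodup) :
    Perm.sign ([a, b, c, d].formPerm * [e, f, g, h].formPerm) = 1 := by
  rw [map_mul, (List.isCycle_formPerm h₁ (by simp)).sign, (List.isCycle_formPerm h₂ (by simp)).sign,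
    List.support_formPerm_of_nodup _ h₁ (by simp), List.support_formPerm_of_nodup _ h₂ (by simp),
    List.toFinset_card_of_nodup h₁, List.toFinset_card_of_nodup h₂]
  simp

theorem cubeGroup_le_legalGroup : cubeGroup ≤ legalGroup := by
  refine (Subgroup.closure_le _).2 ?_
  rintro g (rfl | rfl | rfl | rfl | rfl | rfl)
  · exact ⟨[1, 3, 7, 5].formPerm * [10, 14, 18, 13].formPerm,
      ![0, 2, 0, 4, 0, 4, 0, 2, 0, 0, 0, 0, 0, 0, 0, 0, 0, 0, 0, 0, 0, 0, 0, 0, 0, 0],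
      sign_formPerm_mul_formPerm (by decide) (by decide), by decide +kernel, by decide +kernel,
      by decide +kernel, by decide +kernel⟩
  · exact ⟨[0, 4, 6, 2].formPerm * [9, 12, 17, 15].formPerm,
      ![4, 0, 2, 0, 2, 0, 4, 0, 0, 0, 0, 0, 0, 0, 0, 0, 0, 0, 0, 0, 0, 0, 0, 0, 0, 0],
      sign_formPerm_mul_formPerm (by decide) (by decide), by decide +kernel, by decide +kernel,
      by decide +kernel, by decide +kernel⟩
  · exact ⟨[0, 2, 3, 1].formPerm * [8, 9, 11, 10].formPerm,
      ![0, 0, 0, 0, 0, 0, 0, 0, 0, 0, 0, 0, 0, 0, 0, 0, 0, 0, 0, 0, 0, 0, 0, 0, 0, 0],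
      sign_formPerm_mul_formPerm (by decide) (by decide), by decide +kernel, by decide +kernel,
      by decide +kernel, by decide +kernel⟩
  · exact ⟨[4, 5, 7, 6].formPerm * [16, 18, 19, 17].formPerm,
      ![0, 0, 0, 0, 0, 0, 0, 0, 0, 0, 0, 0, 0, 0, 0, 0, 0, 0, 0, 0, 0, 0, 0, 0, 0, 0],
      sign_formPerm_mul_formPerm (by decide) (by decide), by decide +kernel, by decide +kernel,
      by decide +kernel, by decide +kernel⟩
  · exact ⟨[0, 1, 5, 4].formPerm * [8, 13, 16, 12].formPerm,
      ![2, 4, 0, 0, 4, 2, 0, 0, 3, 0, 0, 0, 3, 3, 0, 0, 3, 0, 0, 0, 0, 0, 0, 0, 0, 0],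
      sign_formPerm_mul_formPerm (by decide) (by decide), by decide +kernel, by decide +kernel,
      by decide +kernel, by decide +kernel⟩
  · exact ⟨[2, 6, 7, 3].formPerm * [11, 15, 19, 14].formPerm,
      ![0, 0, 4, 2, 0, 0, 2, 4, 0, 0, 0, 3, 0, 0, 3, 3, 0, 0, 0, 3, 0, 0, 0, 0, 0, 0],
      sign_formPerm_mul_formPerm (by decide) (by decide), by decide +kernel, by decide +kernel,
      by decide +kernel, by decide +kernel⟩

namespace IsLegal

variable {h : Perm Sticker} {σ : Perm (Fin 26)} {v : Fin 26 → ZMod 6}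

theorem apply_piece_of_fixed (hh : IsLegal h σ v) {x : Sticker} (hx : h x = x) :
    σ (piece x) = piece x := by
  rw [← hh.piece_apply, hx]

theorem rotation_piece_of_fixed (hh : IsLegal h σ v) {x : Sticker} (hx : h x = x) :
    v (piece x) = 0 := by
  simpa [hx] using hh.orient_apply x

theorem three_mul_rotation_of_corner (hh : IsLegal h σ v) {i : Fin 26} (hi : kind i = 0) :
    3 * v i = 0 := by
  obtain ⟨x, rfl⟩ := exists_piece_eq i
  have h₁ := congrArg (3 * ·) (hh.orient_apply x)
  have h₂ := three_mul_orient_of_corner (h x) (by rw [hh.piece_apply, hh.kind_eq, hi])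
  simpa [mul_add, three_mul_orient_of_corner x hi, h₂] using h₁.symm

theorem two_mul_rotation_of_edge (hh : IsLegal h σ v) {i : Fin 26} (hi : kind i = 1) :
    2 * v i = 0 := by
  obtain ⟨x, rfl⟩ := exists_piece_eq i
  have h₁ := congrArg (2 * ·) (hh.orient_apply x)
  have h₂ := two_mul_orient_of_edge (h x) (by rw [hh.piece_apply, hh.kind_eq, hi])
  simpa [mul_add, two_mul_orient_of_edge x hi, h₂] using h₁.symm

theorem rotation_of_centre (hh : IsLegal h σ v) {i : Fin 26} (hi : 2 ≤ kind i) : v i = 0 := by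
  obtain ⟨x, rfl⟩ := exists_piece_eq i
  have h₁ := hh.orient_apply x
  have h₂ := orient_of_centre (h x) (by rwa [hh.piece_apply, hh.kind_eq])
  simpa [orient_of_centre x hi, h₂] using h₁.symm

theorem apply_of_centre (hh : IsLegal h σ v) {i : Fin 26} (hi : 2 ≤ kind i) : σ i = i := by
  have : ∀ i j, 2 ≤ kind i → kind j = kind i → j = i := by decide +kernel
  exact this _ _ hi (hh.kind_eq i)

end IsLegal

/-! ### Descending the stabiliser chain -/

/-- The stickers to which a legal permutation that fixes the stickers of `c` may send `b`: those on
pieces of the same kind that carry no sticker of `c`. -/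
def candidates (c : List Sticker) (b : Sticker) : List Sticker :=
  (List.finRange 54).filter fun x =>
    kind (piece x) = kind (piece b) ∧ ∀ y ∈ c, piece x ≠ piece y

theorem apply_mem_candidates {h : Perm Sticker} (hh : h ∈ legalGroup) {c : List Sticker}
    {b : Sticker} (hc : ∀ y ∈ c, h y = y) (hb : ∀ y ∈ c, piece b ≠ piece y) :
    h b ∈ candidates c b := by
  obtain ⟨σ, v, hh⟩ := hh
  simp only [candidates, List.mem_filter, List.mem_finRange, true_and, decide_eq_true_eq]
  refine ⟨by rw [hh.piece_apply, hh.kind_eq], fun y hy he => hb y hy ?_⟩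
  rw [← hc y hy, hh.piece_apply, hh.piece_apply] at he
  exact σ.injective he

/-- A part of a stabiliser chain: each entry consists of a sticker, the base point of its level,
and the words of that level. -/
abbrev Chain : Type := List (Sticker × List Word)

/-- `T` continues the stabiliser chain below the pointwise stabiliser of `c`: in each level the
words fix the earlier base points and carry the base point to all its candidates. -/
def IsChain : List Sticker → Chain → Bool
  | _, [] => true
  | c, (b, ws) :: T =>
    (∀ w ∈ ws, ∀ y ∈ c, w.act y = y) && (∀ y ∈ c, piece b ≠ piece y) &&
      ws.map (fun w => w.act b) == candidates c b && IsChain (b :: c) T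

/-- The base points of a chain below those of `c`, the deepest one first. -/
def basePoints : List Sticker → Chain → List Sticker
  | c, [] => c
  | c, (b, _) :: T => basePoints (b :: c) T

/-- The sum over the levels of the length of the longest word. -/
def cost : Chain → ℕ
  | [] => 0
  | (_, ws) :: T => (ws.map List.length).foldr max 0 + cost T

theorem length_le_foldr_max {ws : List Word} {w : Word} (hw : w ∈ ws) :
    w.length ≤ (ws.map List.length).foldr max 0 :=
  List.le_max_of_le (List.mem_map_of_mem hw) le_rfl

theorem fixes_inv_mul {w h : Perm Sticker} {y : Sticker} (hy : w y = h y) :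
    (w⁻¹ * h) y = y :=
  Perm.inv_eq_iff_eq.2 hy.symm

/-- If every element of the cube group that fixes all base points is a product of at most `n`
moves, then each level above adds at most the length of its longest word. -/
theorem isProd_of_isChain {n : ℕ} {T : Chain} {c : List Sticker} (hT : IsChain c T)
    (hn : ∀ h ∈ cubeGroup, (∀ y ∈ basePoints c T, h y = y) → IsProd h n)
    {h : Perm Sticker} (hh : h ∈ cubeGroup) (hc : ∀ y ∈ c, h y = y) : IsProd h (cost T + n) := by
  induction T generalizing c h with
  | nil => simpa [cost] using hn h hh hc
  | cons e T ih =>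
    obtain ⟨b, ws⟩ := e
    simp only [IsChain, Bool.and_eq_true, decide_eq_true_eq, beq_iff_eq] at hT
    obtain ⟨⟨⟨hfix, hb⟩, hws⟩, hT⟩ := hT
    have hmem := apply_mem_candidates (cubeGroup_le_legalGroup hh) hc hb
    rw [← hws, List.mem_map] at hmem
    obtain ⟨w, hw, hwb⟩ := hmem
    rw [cost, add_assoc]
    refine IsProd.of_inv_mul (length_le_foldr_max hw)
      (ih hT hn (mul_mem (inv_mem w.perm_mem_cubeGroup) hh) ?_)
    simp only [List.mem_cons, forall_eq_or_imp]
    refine ⟨fixes_inv_mul (by rw [w.perm_apply, hwb]), fun y hy => fixes_inv_mul ?_⟩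
    rw [w.perm_apply, hfix w hw y hy, hc y hy]

/-! ### The words -/

section Words

open Turn

/-- Words for all levels but the last. The down edges come first, then the four down corners, each
followed by the edge above it, then the up edges other than up-left, and the two front up corners.
The words of a level are sorted by the image of the base point. -/
def wordTable : Chain := [
  (47, [[B2, D2], [L2, D3], [R2, D1], [F2], [L3, F1], [B3, D2], [F1], [L1, F1], [F3, R1, D1],
    [L3, D3], [R1, D1], [F1, R1, D1], [R1, F3], [F3], [B1, D2], [R3, F3], [B1, R3, D1], [R3, D1],
    [L1, D3], [B3, R3, D1], [], [D3], [D1], [D2]]),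
  (51, [[U3, R2], [U2, R2], [R2], [U1, R2], [U3, B1, R3], [B1, U3, R2], [D1, F1, D3],
    [D3, F1, D1, R1], [U2, B1, R3], [L1, U2, R2], [R1], [U1, B1, R3], [D1, F3, D3], [B3, U3, R2],
    [D1, F1, D3, R1], [B1, R3], [R3], [B2, R3], [B3, R3], [L2, U2, R2], [], [B2, U3, R2]]),
  (53, [[B2], [U3, B2], [U1, B2], [U2, B2], [L1, B3], [B3], [L2, B3], [L3, B3], [U3, L1, B3],
    [D3, L3, D1], [D1, R1, D3], [R3, B1, R1], [R2, B1, R2], [B1], [U1, L1, B3], [D1, R3, D3],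
    [D3, L1, D1], [B1, D3, L1, D1], [L2, U3, B2], []]),
  (49, [[U1, L2], [L2], [U2, L2], [U3, L2], [B1, U3, B3, L1], [D1, B3, D3], [D3, F1, D1],
    [D1, B1, D3, L1], [F1, L3, F3], [L3], [D2, R1, D2], [B1, U1, B3, L1], [D3, F3, D1],
    [D1, B1, D3], [B3, L1, B1], [D2, R3, D2], [L1], []]),
  (48, [[F3, R2, F1, R1, U1, R1], [R3, B1, U3, B3, R1], [B2, R2, B2, R2], [F2, R2, F2, R2],
    [B1, R3, B3, U2, R1], [F1, U2, F3], [R3, U1, R1], [F1, L3, U2, F3, L1], [L1, R3, U1, L3, R1],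
    [U1, R3, U3, R1], [F1, U1, F3], [F3, U3, F2, U2, F3], [R3, U3, L1, U2, L3, R1], [R3, U3, R1],
    [U2, R3, U1, R1], [R3, U2, L3, U1, L1, R1], [R1, U2, R2, U1, R1], [F1, U3, F3], [R3, U2, R1],
    [B3, F1, U3, B1, F3], [B1, R3, U2, B3, R1], [L1, U1, R3, U3, L3, R1], [], [F2, L2, F2, L2]]),
  (24, [[R3, F3, U3, F1, R1], [R3, F3, U2, F1, R1], [R3, F2, R1, F2, R1], [R2, U1, R3, U3, R2],
    [L2, D3, F1, D1, L2], [R2, B1, R1, U3, B3, R1], [R3, F3, U1, F1, R1], [L3, D3, F3, D1, L1],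
    [R3, F2, R3, F2, R1], [], [D3, F1, U3, F3, D1], [B2, D2, F3, D3, R3, D3, B2],
    [F1, R1, U3, R3, F3], [R1, B1, R3, B3, R3], [R3, F2, R2, F2, R1], [D3, B2, D1, U3, R2]]),
  (0, [[], [B2, R3, B2, R1], [U1, B2, R3, B2, R1], [U3, B2, R3, B2, R1], [U2, B2, R3, B2, R1],
    [R1, U3, R3], [B3, U2, B1], [L3, R1, U3, L1, R3], [B3, L1, U2, B1, L3], [R1, U2, R3],
    [B3, U1, B1], [R1, F3, U2, F1, R3], [U3, R1, U2, R3], [R1, U1, R3], [B3, U1, B2, R3, B3, R1],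
    [B3, U3, B1], [U3, R1, U1, R3], [R1, U2, F3, R1, F1, R2], [B1, U2, B2, U1, B1],
    [B2, L2, B2, L2], [B1, R1, U3, R2, B3, R1]]),
  (40, [[D2, R1, U3, R3, D2], [R1, B1, U2, B3, R3], [F2, D3, R3, D1, F2], [R1, B1, U1, B3, R3],
    [L2, D1, B3, D3, L2], [R1, B1, U3, B3, R3], [R2, F3, R3, U1, F1, R3], [D2, B3, U2, B1, D2],
    [L2, D1, B2, D3, L2], [D2, B3, U1, B1, D2], [F2, D3, R3, D3, B3, D2, F2], [L2, D1, B1, D3, L2],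
    [], [D1, B2, D3, U1, L2]]),
  (52, [[F1, L3, F3, U2, L1], [U2, L2, B3, L2, B1], [L2, B3, L2, B1], [L3, F1, L3, F3, L2],
    [L3, U3, L1], [U2, L3, U1, L1], [L2, F1, L1, F3, U2, L1], [L1, U2, L2, U1, L1], [B1, U3, B3],
    [L3, U2, L1], [B1, F3, U3, B3, F1], [B1, U2, B3], [L3, U1, L1], [U1, L3, U3, L1], [B1, U1, B3],
    [F1, L2, F3, L1, U2, L1], [B3, L2, B1, L1, U1, L1], []]),
  (42, [[L2, U1, L3, U3, L2], [R2, D2, L1, D2, R2], [R2, D2, L3, D2, R2], [D1, L3, U3, L1, D3],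
    [D1, B1, U3, B3, D3], [L2, F1, L2, F2, L3, U3, L1, F1], [F1, D1, L3, D3, F3],
    [L1, F1, L3, F3, L3], [R2, D2, L2, D2, R2], [D1, B1, U1, B3, D3], [U2, L1, F1, L3, F3, L3],
    []]),
  (46, [[F3, U2, F2, L3, F3, L1], [L1, B3, L1, B1, L2], [L1, B1, U2, B3, L3],
    [U1, L1, B3, L1, B1, L2], [U3, L1, U2, L3], [L1, U1, L3], [F3, U1, F2, L3, F3, L1],
    [F3, U3, F1], [U3, L1, U1, L3], [L1, U2, B3, L1, B1, L2], [L1, U3, L3], [F3, U2, F1],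
    [L1, U2, L3], [F3, U1, F1], []]),
  (22, [[L1, U2, B1, U1, B3, U2, L3], [F1, U2, R1, F3, R3, U2, F3], [L1, U2, B1, U2, B3, U2, L3],
    [B3, L2, U3, L1, U1, L2, B1], [L1, U2, B1, U3, B3, U2, L3],
    [L1, U3, L1, U2, F1, L2, F3, U2, L2], [F1, U2, R1, F1, R3, U2, F3], [],
    [L1, U3, L3, F1, L3, F3, L1], [B3, D3, L2, D1, B2, U3, B3]]),
  (8, [[U2], [U1], [U3], [], [L3, F3, U3, F1, U1, L1], [B3, L3, U3, L1, U1, B1, U2],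
    [R1, F1, U1, F3, U3, R3], [F3, R3, U3, R1, U1, F1]]),
  (6, [[L1, B1, U1, B3, U3, L3], [L1, U2, L3, U3, L1, U3, L3], [], [R3, B3, U3, B1, U1, R1],
    [U3, R1, U1, F1, U3, F3, R3], [R3, U3, B3, U1, B1, R1]]),
  (2, [[], [R1, U1, R3, U1, R1, U2, R3, U1], [B3, L1, F1, L2, B3, F1, R1, D2, R3, B2, F2],
    [B3, U3, B2, R3, B3, R2, U3, R3, U2]]),
  (7, [[B3, L3, F3, L1, B1, L3, F1, L1], [F2, R2, F3, L3, F1, R2, F3, L1, F3], [],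
    [R1, F1, L1, F3, R3, F1, L3, F3], [F1, L2, F1, R2, F3, L2, F1, R2, F2],
    [U2, L3, B1, D2, B3, L1, U2, L3, B1, D2, B3, L1],
    [L3, B1, D2, B3, L1, U2, L3, B1, D2, B3, L1, U2], [L3, F2, L3, B2, L1, F2, L3, B2, L2],
    [R1, U3, L3, U1, R3, U3, L1, U1], [L3, F3, L1, B3, L3, F1, L1, B1],
    [L1, U3, R3, U1, L3, U3, R1, U1], [U3, R3, U1, L1, U3, R1, U1, L3]]),
  (9, [[B3, L1, B3, R2, B1, L3, B3, R2, B2], [B1, R1, F1, R3, B3, R1, F3, R3], [],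
    [R1, F1, R3, B1, R1, F3, R3, B3], [R1, B3, D2, B1, R3, U2, R1, B3, D2, B1, R3, U2],
    [U2, R1, B3, D2, B1, R3, U2, R1, B3, D2, B1, R3], [F3, R2, F3, L2, F1, R2, F3, L2, F2],
    [R1, F1, L3, F3, R3, F1, L1, F3], [R3, U1, L1, U3, R1, U1, L3, U3]])]

/-- The commutator of `(R⁻¹ * D⁻¹ * R * D) ^ 2` and `U⁻¹`. It turns the corner up-back-left clockwise
and the corner up-back-right anticlockwise, and fixes everything else. -/
def twist : Word :=
  [R3, D3, R1, D1, R3, D3, R1, D1, U3, D3, R3, D1, R1, D3, R3, D1, R1, U1]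

end Words

theorem isChain_wordTable : IsChain [] wordTable := by
  decide +kernel

theorem cost_wordTable : cost wordTable = 119 := by
  decide +kernel

/-! ### The last three pieces -/

/-- Every piece other than a centre, the corners `2` and `3` and the edge `9` carries a base point
of the table. -/
theorem exists_basePoint (i : Fin 26) (h2 : i ≠ 2) (h3 : i ≠ 3) (h9 : i ≠ 9) (hi : kind i < 2) :
    ∃ x ∈ basePoints [] wordTable, piece x = i := by
  have : ∀ i : Fin 26, i ≠ 2 → i ≠ 3 → i ≠ 9 → kind i < 2 →
      ∃ x ∈ basePoints [] wordTable, piece x = i := by decide +kernel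
  exact this i h2 h3 h9 hi

section LastPieces

variable {h : Perm Sticker} {σ : Perm (Fin 26)} {v : Fin 26 → ZMod 6}

theorem IsLegal.apply_and_rotation_eq (hh : IsLegal h σ v)
    (hb : ∀ y ∈ basePoints [] wordTable, h y = y) {i : Fin 26}
    (h2 : i ≠ 2) (h3 : i ≠ 3) (h9 : i ≠ 9) : σ i = i ∧ v i = 0 := by
  rcases lt_or_ge (kind i) 2 with hi | hi
  · obtain ⟨x, hx, rfl⟩ := exists_basePoint i h2 h3 h9 hi
    exact ⟨hh.apply_piece_of_fixed (hb x hx), hh.rotation_piece_of_fixed (hb x hx)⟩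
  · exact ⟨hh.apply_of_centre hi, hh.rotation_of_centre hi⟩

/-- The edge `9` stays in place as it is the only one left, and the corners `2` and `3` stay in
place as their exchange would be an odd permutation of the pieces. -/
theorem IsLegal.perm_eq_one (hh : IsLegal h σ v)
    (hb : ∀ y ∈ basePoints [] wordTable, h y = y) : σ = 1 := by
  have hfix {i : Fin 26} (h2 : i ≠ 2) (h3 : i ≠ 3) (h9 : i ≠ 9) : σ i = i :=
    (hh.apply_and_rotation_eq hb h2 h3 h9).1
  -- The image of one of the three pieces is again one of them, of the same kind.
  have himage {i : Fin 26} (hi : i = 2 ∨ i = 3 ∨ i = 9) : σ i = 2 ∨ σ i = 3 ∨ σ i = 9 := by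
    by_contra! hne
    have := σ.injective (hfix hne.1 hne.2.1 hne.2.2)
    rcases hi with rfl | rfl | rfl <;> simp_all
  have h9 : σ 9 = 9 := by
    have hk := hh.kind_eq 9
    rcases himage (i := 9) (by simp) with e | e | e
    · rw [e] at hk; exact absurd hk (by decide)
    · rw [e] at hk; exact absurd hk (by decide)
    · exact e
  have hcorner {i : Fin 26} (hi : i = 2 ∨ i = 3) : σ i = 2 ∨ σ i = 3 := by
    rcases himage (i := i) (by tauto) with e | e | e
    · exact Or.inl e
    · exact Or.inr e
    · have := σ.injective (e.trans h9.symm)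
      rcases hi with rfl | rfl <;> exact absurd this (by decide)
  have hne : σ 2 ≠ σ 3 := fun e => absurd (σ.injective e) (by decide)
  rcases hcorner (i := 2) (by simp) with e2 | e2
  · have e3 : σ 3 = 3 := (hcorner (i := 3) (by simp)).resolve_left fun e => hne (e2.trans e.symm)
    ext1 i
    by_cases i2 : i = 2
    · rw [i2, e2]; rfl
    by_cases i3 : i = 3
    · rw [i3, e3]; rfl
    by_cases i9 : i = 9
    · rw [i9, h9]; rfl
    exact hfix i2 i3 i9
  · have e3 : σ 3 = 2 := (hcorner (i := 3) (by simp)).resolve_right fun e => hne (e2.trans e.symm)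
    have : σ = swap 2 3 := by
      ext1 i
      by_cases i2 : i = 2
      · rw [i2, e2, swap_apply_left]
      by_cases i3 : i = 3
      · rw [i3, e3, swap_apply_right]
      rw [swap_apply_of_ne_of_ne i2 i3]
      by_cases i9 : i = 9
      · rw [i9, h9]
      exact hfix i2 i3 i9
    have hs := hh.sign_eq
    rw [this, Perm.sign_swap (by decide)] at hs
    exact absurd hs (by decide)

end LastPieces

theorem upBackLeft_mem {h : Perm Sticker} (hh : h ∈ legalGroup)
    (hb : ∀ y ∈ basePoints [] wordTable, h y = y) : h 1 = 1 ∨ h 1 = 10 ∨ h 1 = 39 := by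
  obtain ⟨σ, v, hh⟩ := hh
  have hp := hh.piece_apply 1
  rw [hh.perm_eq_one hb, Perm.one_apply] at hp
  have : ∀ x, piece x = piece 1 → x = 1 ∨ x = 10 ∨ x = 39 := by decide +kernel
  exact this _ hp

theorem eq_one_of_fixes_all_but_two {h : Perm Sticker} (hh : h ∈ legalGroup)
    (hb : ∀ y ∈ basePoints [] wordTable, h y = y) (h1 : h 1 = 1) : h = 1 := by
  obtain ⟨σ, v, hh⟩ := hh
  have hv2 : v 2 = 0 := hh.rotation_piece_of_fixed h1
  have hv {i : Fin 26} (h3 : i ≠ 3) (h9 : i ≠ 9) : v i = 0 := by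
    by_cases h2 : i = 2
    · rw [h2, hv2]
    · exact (hh.apply_and_rotation_eq hb h2 h3 h9).2
  -- The rotation of the corner `3` has order dividing three, that of the edge `9` order dividing
  -- two, and the two have sum zero.
  have hsum : v 3 + v 9 = 0 := by
    rw [← hh.sum_eq]
    exact (Fintype.sum_eq_add 3 9 (by decide) fun i hi => hv hi.1 hi.2).symm
  have key : ∀ a b : ZMod 6, a + b = 0 → 3 * a = 0 → 2 * b = 0 → a = 0 ∧ b = 0 := by decide
  obtain ⟨hv3, hv9⟩ := key _ _ hsum (hh.three_mul_rotation_of_corner (by decide))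
    (hh.two_mul_rotation_of_edge (by decide))
  have hv0 (i : Fin 26) : v i = 0 := by
    by_cases h3 : i = 3
    · rw [h3, hv3]
    by_cases h9 : i = 9
    · rw [h9, hv9]
    exact hv h3 h9
  ext1 x
  refine sticker_ext ?_ ?_
  · rw [hh.piece_apply, hh.perm_eq_one hb]; rfl
  · rw [hh.orient_apply, hv0, add_zero]; rfl

theorem isProd_of_fixes_basePoints {h : Perm Sticker} (hh : h ∈ cubeGroup)
    (hb : ∀ y ∈ basePoints [] wordTable, h y = y) : IsProd h 36 := by
  have finish {w : Word} (hw : w.length ≤ 36) (hwb : ∀ y ∈ basePoints [] wordTable, w.act y = y)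
      (h1 : h 1 = w.act 1) : IsProd h 36 := by
    refine ⟨w, hw, inv_mul_eq_one.1 (eq_one_of_fixes_all_but_two ?_ (fun y hy => ?_) ?_)⟩
    · exact cubeGroup_le_legalGroup (mul_mem (inv_mem w.perm_mem_cubeGroup) hh)
    · exact fixes_inv_mul (by rw [w.perm_apply, hwb y hy, hb y hy])
    · exact fixes_inv_mul (by rw [w.perm_apply, h1])
  rcases upBackLeft_mem (cubeGroup_le_legalGroup hh) hb with h1 | h1 | h1
  · exact finish (w := []) (by decide) (fun y _ => rfl) h1
  · exact finish (w := twist) (by decide) (by decide +kernel) (h1.trans (by decide +kernel))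
  · exact finish (w := twist ++ twist) (by decide) (by decide +kernel)
      (h1.trans (by decide +kernel))

end Rubik

theorem mainTheorem3 : ∀ g ∈ Rubik.cubeGroup, Rubik.SolvableIn g 205 := by
  intro g hg
  have h := Rubik.isProd_of_isChain Rubik.isChain_wordTable
    (fun _ => Rubik.isProd_of_fixes_basePoints) (inv_mem hg) (by simp)
  rw [Rubik.cost_wordTable] at h
  exact .of_isProd_inv (h.mono (by norm_num))
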